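/- **Lemma (Nonlinear monogamy of entanglement on a star).** Let $G=(V,E,w)$ be a finite simple graph with positive edge weights, $n=|V|$, with one qubit at each vertex, and let $X_i,Y_i,Z_i$ be the Pauli matrices acting on qubit $i$. For $i\ne j$ put $$h_{ij}=\tfrac12\,(I+X_iX_j-Y_iY_j+Z_iZ_j),\qquad H(G)=\sum_{(i,j)\in E}w_{ij}h_{ij}.$$ Let $i\in V$ have degree $d_i\ge 2$, let $N(i)$ be its set of neighbours, and let $j\in N(i)$. We say that real numbers $g$ satisfy the *star bound* at $(i,j)$ if $-1\le g_{ij}\le 1$ and $$\sum_{k\in N(i)\setminus\{j\}} g_{ik}\;\le\;\begin{cases}1, & \text{if } -1\le g_{ij}<-\frac1{d_i},\\[2pt] \frac12\Big(2-d_i-g_{ij}+\sqrt{(d_i^2-1)(1-g_{ij}^2)}\Big), & \text{if } -\frac1{d_i}\le g_{ij}\le 1.\end{cases}$$ 1. For every unit vector $|\psi\rangle\in(\mathbb C^2)^{\otimes V}$, the values $g_{ij}=\langle\psi|h_{ij}|\psi\rangle-1$ satisfy the star bound at $(i,j)$. 2. For $k\ge 0$ let $\mathcal P_k$ be the set of Pauli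 monomials on the $n$ qubits with at most $k$ non-identity factors, and let $\mathcal M_k$ be the set of real symmetric matrices $\Gamma\in\mathbb R^{\mathcal P_k\times\mathcal P_k}$ such that $\Gamma\succeq0$; $\Gamma(A,A)=1$ for all $A\in\mathcal P_k$; $\Gamma(A,B)=\Gamma(A',B')$ whenever $AB=A'B'$; $\Gamma(A,B)=-\Gamma(A',B')$ whenever $AB=-A'B'$; and $\Gamma(A,B)=0$ whenever $AB$ is not Hermitian. For $\Gamma\in\mathcal M_k$ let $L$ be the real linear functional on $\mathrm{span}_{\mathbb R}\,\mathcal P_{2k}$ with $L(C)=\Gamma(A,B)$ whenever $C=AB$ with $A,B\in\mathcal P_k$, and put $$g_{ij}=\tfrac12\big(-1+L(X_iX_j)-L(Y_iY_j)+L(Z_iZ_j)\big).$$ Then for every $k\ge2$ and every $\Gamma\in\mathcal M_k$ the values $g$ satisfy the star bound at $(i,j)$. In particular this holds for every optimal solution $\Gamma$ of the level-$k$ quantum moment-SoS relaxation $\max\{L(H(G)) : \Gamma\in\mathcal M_k\}$. -/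

import Mathlib

/-! ### Pauli operators on qubits labelled by a finite type `V`

The Hilbert space of the qubits has the computational basis `V → Fin 2`; operators are complex
matrices indexed by this basis. -/

/-- The labels of the four single-qubit Pauli matrices. -/
inductive PauliLabel
  | I
  | X
  | Y
  | Z
  deriving DecidableEq

instance : Fintype PauliLabel :=
  ⟨{.I, .X, .Y, .Z}, by intro a; cases a <;> simp⟩

/-- The single-qubit Pauli matrices. -/
noncomputable def PauliLabel.mat : PauliLabel → Matrix (Fin 2) (Fin 2) ℂ
  | .I => !![1, 0; 0, 1]
  | .X => !![0, 1; 1, 0]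
  | .Y => !![0, -Complex.I; Complex.I, 0]
  | .Z => !![1, 0; 0, -1]

/-- Operators on the space of the qubits `V`. -/
abbrev QubitOp (V : Type*) : Type _ := Matrix (V → Fin 2) (V → Fin 2) ℂ

/-- The tensor product, over all qubits, of single-qubit operators. -/
noncomputable def qubitTensor {V : Type*} [Fintype V] (M : V → Matrix (Fin 2) (Fin 2) ℂ) :
    QubitOp V :=
  Matrix.of fun x y => ∏ v, M v (x v) (y v)

/-- The operator of a Pauli string. -/
noncomputable def pauliOp {V : Type*} [Fintype V] (s : V → PauliLabel) : QubitOp V :=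
  qubitTensor fun v => (s v).mat

/-- The Pauli matrix with label `a` acting on qubit `i` (and the identity elsewhere). -/
noncomputable def siteOp {V : Type*} [Fintype V] [DecidableEq V] (a : PauliLabel) (i : V) :
    QubitOp V :=
  pauliOp (Function.update (fun _ => PauliLabel.I) i a)

/-- The set `𝒫ₖ` of Pauli monomials with at most `k` non-identity factors, as strings. -/
abbrev PauliMonomial (V : Type*) [Fintype V] (k : ℕ) : Type _ :=
  {s : V → PauliLabel // (Finset.univ.filter fun v => s v ≠ PauliLabel.I).card ≤ k}

/-- The real span `𝒪ₖ` of `𝒫ₖ`. -/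
noncomputable def pauliSpan (V : Type*) [Fintype V] (k : ℕ) : Submodule ℝ (QubitOp V) :=
  Submodule.span ℝ (Set.range fun A : PauliMonomial V k => pauliOp A.1)

/-! ### The EPR Hamiltonian -/

/-- The edge term `h_ij = (I + X_i X_j - Y_i Y_j + Z_i Z_j) / 2`. -/
noncomputable def eprTerm {V : Type*} [Fintype V] [DecidableEq V] (i j : V) : QubitOp V :=
  (1 / 2 : ℝ) • (1 + siteOp .X i * siteOp .X j - siteOp .Y i * siteOp .Y j
    + siteOp .Z i * siteOp .Z j)

theorem qubitTensor_mul {V : Type*} [Fintype V] [DecidableEq V]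
    (M N : V → Matrix (Fin 2) (Fin 2) ℂ) :
    qubitTensor M * qubitTensor N = qubitTensor fun v => M v * N v := by
  ext x y
  simp only [qubitTensor, Matrix.mul_apply, Matrix.of_apply, ← Finset.prod_mul_distrib]
  rw [Finset.prod_univ_sum, Fintype.piFinset_univ]

theorem siteOp_mul_comm {V : Type*} [Fintype V] [DecidableEq V] (a : PauliLabel) (i j : V) :
    siteOp a i * siteOp a j = siteOp a j * siteOp a i := by
  simp only [siteOp, pauliOp, qubitTensor_mul]
  congr 1
  funext v
  have h1 : PauliLabel.I.mat = 1 := by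
    ext p q; fin_cases p <;> fin_cases q <;> simp [PauliLabel.mat]
  simp only [Function.update_apply]
  split_ifs <;> simp [h1]

theorem eprTerm_comm {V : Type*} [Fintype V] [DecidableEq V] (i j : V) :
    eprTerm i j = eprTerm j i := by
  simp only [eprTerm, siteOp_mul_comm _ i j]

/-- The EPR Hamiltonian `H(G) = ∑_{(i,j) ∈ E} w_ij h_ij` of a weighted graph. -/
noncomputable def eprHamiltonian {V : Type*} [Fintype V] [DecidableEq V] (G : SimpleGraph V)
    [DecidableRel G.Adj] (w : Sym2 V → ℝ) : QubitOp V :=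
  ∑ e ∈ G.edgeFinset, w e • Sym2.lift ⟨eprTerm, eprTerm_comm⟩ e

/-- The value `g_ij = ⟨ψ| h_ij |ψ⟩ - 1` of a state vector `ψ`. -/
noncomputable def stateValue {V : Type*} [Fintype V] [DecidableEq V]
    (ψ : EuclideanSpace ℂ (V → Fin 2)) (i j : V) : ℝ :=
  (star ψ.ofLp ⬝ᵥ (eprTerm i j).mulVec ψ.ofLp).re - 1

/-! ### The quantum moment-SoS hierarchy -/

/-- Membership in the set `ℳₖ` of level-`k` moment matrices. (`Matrix.PosSemidef` includes
symmetry.) -/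
structure IsMomentMatrix {V : Type*} [Fintype V] [DecidableEq V] {k : ℕ}
    (Γ : Matrix (PauliMonomial V k) (PauliMonomial V k) ℝ) : Prop where
  posSemidef : Γ.PosSemidef
  eq_of_mul_eq : ∀ A B A' B' : PauliMonomial V k,
    pauliOp A.1 * pauliOp B.1 = pauliOp A'.1 * pauliOp B'.1 → Γ A B = Γ A' B'
  eq_neg_of_mul_eq_neg : ∀ A B A' B' : PauliMonomial V k,
    pauliOp A.1 * pauliOp B.1 = -(pauliOp A'.1 * pauliOp B'.1) → Γ A B = -Γ A' B'
  eq_zero : ∀ A B : PauliMonomial V k, ¬ (pauliOp A.1 * pauliOp B.1).IsHermitian → Γ A B = 0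
  diag : ∀ A : PauliMonomial V k, Γ A A = 1

open Classical in
/-- The value `L(P)` on a Pauli string `P`: it is `Γ(A,B)` for a factorization `P = A B` with
`A, B ∈ 𝒫ₖ`. -/
noncomputable def pauliMoment {V : Type*} [Fintype V] [DecidableEq V] {k : ℕ}
    (Γ : Matrix (PauliMonomial V k) (PauliMonomial V k) ℝ) (P : V → PauliLabel) : ℝ :=
  if h : ∃ AB : PauliMonomial V k × PauliMonomial V k,
      pauliOp AB.1.1 * pauliOp AB.2.1 = pauliOp P
  then Γ h.choose.1 h.choose.2 else 0

/-- The pseudo-expectation `L` of a moment matrix: the real linear functional on `𝒪₂ₖ` with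
`L(C) = Γ(A,B)` whenever `C = A B` with `A, B ∈ 𝒫ₖ` (see `pseudoExpectation_eq`). The coefficient
of the Pauli string `P` in an operator `C` is `tr(P C) / 2 ^ n`; through this formula `L` is
written as a functional on all operators, but only its values on `𝒪₂ₖ` matter. -/
noncomputable def pseudoExpectation {V : Type*} [Fintype V] [DecidableEq V] {k : ℕ}
    (Γ : Matrix (PauliMonomial V k) (PauliMonomial V k) ℝ) (C : QubitOp V) : ℝ :=
  ∑ P : PauliMonomial V (2 * k),
    ((pauliOp P.1 * C).trace.re / 2 ^ Fintype.card V) * pauliMoment Γ P.1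

theorem pseudoExpectation_add {V : Type*} [Fintype V] [DecidableEq V] {k : ℕ}
    (Γ : Matrix (PauliMonomial V k) (PauliMonomial V k) ℝ) (C D : QubitOp V) :
    pseudoExpectation Γ (C + D) = pseudoExpectation Γ C + pseudoExpectation Γ D := by
  simp only [pseudoExpectation, ← Finset.sum_add_distrib]
  refine Finset.sum_congr rfl fun P _ => ?_
  rw [mul_add, Matrix.trace_add, Complex.add_re]
  ring

theorem pseudoExpectation_smul {V : Type*} [Fintype V] [DecidableEq V] {k : ℕ}
    (Γ : Matrix (PauliMonomial V k) (PauliMonomial V k) ℝ) (r : ℝ) (C : QubitOp V) :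
    pseudoExpectation Γ (r • C) = r * pseudoExpectation Γ C := by
  simp only [pseudoExpectation, Finset.mul_sum]
  refine Finset.sum_congr rfl fun P _ => ?_
  rw [Matrix.mul_smul, Matrix.trace_smul, Complex.smul_re, smul_eq_mul]
  ring

theorem trace_qubitTensor {V : Type*} [Fintype V] [DecidableEq V]
    (M : V → Matrix (Fin 2) (Fin 2) ℂ) : (qubitTensor M).trace = ∏ v, (M v).trace := by
  simp only [qubitTensor, Matrix.trace, Matrix.diag_apply, Matrix.of_apply]
  rw [Finset.prod_univ_sum, Fintype.piFinset_univ]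

theorem PauliLabel.trace_mul (a b : PauliLabel) :
    (a.mat * b.mat).trace = if a = b then 2 else 0 := by
  cases a <;> cases b <;> simp [PauliLabel.mat, Matrix.trace_fin_two] <;> norm_num

theorem trace_pauliOp_mul {V : Type*} [Fintype V] [DecidableEq V] (s t : V → PauliLabel) :
    (pauliOp s * pauliOp t).trace = if s = t then 2 ^ Fintype.card V else 0 := by
  rw [pauliOp, pauliOp, qubitTensor_mul, trace_qubitTensor]
  simp only [PauliLabel.trace_mul]
  split_ifs with h
  · simp [h]
  · obtain ⟨v, hv⟩ := Function.ne_iff.mp h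
    exact Finset.prod_eq_zero (Finset.mem_univ v) (by simp [hv])

theorem pseudoExpectation_pauliOp {V : Type*} [Fintype V] [DecidableEq V] {k : ℕ}
    (Γ : Matrix (PauliMonomial V k) (PauliMonomial V k) ℝ) (P : PauliMonomial V (2 * k)) :
    pseudoExpectation Γ (pauliOp P.1) = pauliMoment Γ P.1 := by
  rw [pseudoExpectation, Finset.sum_eq_single P]
  · rw [trace_pauliOp_mul, if_pos rfl]
    have : ((2 : ℂ) ^ Fintype.card V).re = 2 ^ Fintype.card V := by
      rw [← Complex.ofReal_ofNat, ← Complex.ofReal_pow, Complex.ofReal_re]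
    rw [this, div_self (by positivity), one_mul]
  · intro Q _ hQ
    rw [trace_pauliOp_mul, if_neg fun h => hQ (Subtype.ext h)]
    simp
  · simp

theorem PauliLabel.exists_mul (a b : PauliLabel) :
    ∃ (c : PauliLabel) (z : ℂ), a.mat * b.mat = z • c.mat ∧ z ^ 4 = 1 ∧
      (c ≠ .I → a ≠ .I ∨ b ≠ .I) := by
  cases a <;> cases b
  case I.I => exact ⟨.I, 1, by simp [PauliLabel.mat], by simp, by simp⟩
  case I.X => exact ⟨.X, 1, by simp [PauliLabel.mat], by simp, by simp⟩
  case I.Y => exact ⟨.Y, 1, by simp [PauliLabel.mat], by simp, by simp⟩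
  case I.Z => exact ⟨.Z, 1, by simp [PauliLabel.mat], by simp, by simp⟩
  case X.I => exact ⟨.X, 1, by simp [PauliLabel.mat], by simp, by simp⟩
  case Y.I => exact ⟨.Y, 1, by simp [PauliLabel.mat], by simp, by simp⟩
  case Z.I => exact ⟨.Z, 1, by simp [PauliLabel.mat], by simp, by simp⟩
  case X.X => exact ⟨.I, 1, by simp [PauliLabel.mat], by simp, by simp⟩
  case Y.Y => exact ⟨.I, 1, by simp [PauliLabel.mat], by simp, by simp⟩
  case Z.Z => exact ⟨.I, 1, by simp [PauliLabel.mat], by simp, by simp⟩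
  case X.Y => exact ⟨.Z, Complex.I, by simp [PauliLabel.mat], by norm_num [pow_succ, Complex.I_mul_I, mul_assoc], by simp⟩
  case Y.X => exact ⟨.Z, -Complex.I, by simp [PauliLabel.mat], by norm_num [pow_succ, Complex.I_mul_I, mul_assoc], by simp⟩
  case Y.Z => exact ⟨.X, Complex.I, by simp [PauliLabel.mat], by norm_num [pow_succ, Complex.I_mul_I, mul_assoc], by simp⟩
  case Z.Y => exact ⟨.X, -Complex.I, by simp [PauliLabel.mat], by norm_num [pow_succ, Complex.I_mul_I, mul_assoc], by simp⟩
  case Z.X => exact ⟨.Y, Complex.I, by simp [PauliLabel.mat], by norm_num [pow_succ, Complex.I_mul_I, mul_assoc], by simp⟩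
  case X.Z => exact ⟨.Y, -Complex.I, by simp [PauliLabel.mat], by norm_num [pow_succ, Complex.I_mul_I, mul_assoc], by simp⟩

theorem exists_pauliOp_mul {V : Type*} [Fintype V] [DecidableEq V] {k : ℕ}
    (A B : PauliMonomial V k) :
    ∃ (P : PauliMonomial V (2 * k)) (z : ℂ), pauliOp A.1 * pauliOp B.1 = z • pauliOp P.1 ∧
      z ^ 4 = 1 := by
  choose c z h1 h2 h3 using PauliLabel.exists_mul
  refine ⟨⟨fun v => c (A.1 v) (B.1 v), ?_⟩, ∏ v, z (A.1 v) (B.1 v), ?_, ?_⟩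
  · have hsub : (Finset.univ.filter fun v => c (A.1 v) (B.1 v) ≠ PauliLabel.I) ⊆
        (Finset.univ.filter fun v => A.1 v ≠ PauliLabel.I) ∪
        (Finset.univ.filter fun v => B.1 v ≠ PauliLabel.I) := by
      intro v hv
      simpa using h3 _ _ (by simpa using hv)
    have := (Finset.card_le_card hsub).trans (Finset.card_union_le _ _)
    have hA := A.2
    have hB := B.2
    exact this.trans (by omega)
  · rw [pauliOp, pauliOp, qubitTensor_mul]
    ext x y
    simp [h1, pauliOp, qubitTensor, Finset.prod_mul_distrib]
  · simp [← Finset.prod_pow, h2]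

theorem exists_pauliOp_factorization {V : Type*} [Fintype V] [DecidableEq V] {k : ℕ}
    (P : PauliMonomial V (2 * k)) :
    ∃ AB : PauliMonomial V k × PauliMonomial V k,
      pauliOp AB.1.1 * pauliOp AB.2.1 = pauliOp P.1 := by
  set S := Finset.univ.filter fun v => P.1 v ≠ PauliLabel.I with hS
  have hcard : S.card ≤ 2 * k := P.2
  obtain ⟨T, hT, hTc⟩ := Finset.exists_subset_card_eq (Nat.min_le_right k S.card)
  have hI : PauliLabel.I.mat = 1 := by
    ext p q; fin_cases p <;> fin_cases q <;> simp [PauliLabel.mat]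
  refine ⟨(⟨fun v => if v ∈ T then P.1 v else .I, ?_⟩,
    ⟨fun v => if v ∈ T then .I else P.1 v, ?_⟩), ?_⟩
  · refine (Finset.card_le_card (t := T) ?_).trans (by omega)
    intro v hv
    by_contra hvT
    simp [hvT] at hv
  · refine (Finset.card_le_card (t := S \ T) ?_).trans ?_
    · intro v hv
      by_cases hvT : v ∈ T
      · simp [hvT] at hv
      · simpa [hvT, hS] using hv
    · rw [Finset.card_sdiff_of_subset hT]
      omega
  · simp only [pauliOp, qubitTensor_mul]
    congr 1
    funext v
    by_cases hvT : v ∈ T <;> simp [hvT, hI]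

theorem pauliOp_isHermitian {V : Type*} [Fintype V] (s : V → PauliLabel) :
    (pauliOp s).IsHermitian := by
  ext x y
  simp only [pauliOp, qubitTensor, Matrix.conjTranspose_apply, Matrix.of_apply, star_prod]
  refine Finset.prod_congr rfl fun v _ => ?_
  have : ((s v).mat).IsHermitian := by
    cases s v <;> ext p q <;> fin_cases p <;> fin_cases q <;> simp [PauliLabel.mat]
  exact this.apply _ _

theorem isHermitian_of_mem_pauliSpan {V : Type*} [Fintype V] {k : ℕ} {C : QubitOp V}
    (hC : C ∈ pauliSpan V k) : C.IsHermitian := by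
  refine Submodule.span_induction ?_ Matrix.isHermitian_zero (fun _ _ _ _ h h' => h.add h') ?_ hC
  · rintro _ ⟨A, rfl⟩
    exact pauliOp_isHermitian A.1
  · intro r D _ hD
    rw [Matrix.IsHermitian, Matrix.conjTranspose_smul, hD.eq, star_trivial]

/-- The defining property of the pseudo-expectation. -/
theorem pseudoExpectation_eq {V : Type*} [Fintype V] [DecidableEq V] {k : ℕ}
    {Γ : Matrix (PauliMonomial V k) (PauliMonomial V k) ℝ} (hΓ : IsMomentMatrix Γ)
    {C : QubitOp V} (hC : C ∈ pauliSpan V (2 * k)) (A B : PauliMonomial V k)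
    (hAB : C = pauliOp A.1 * pauliOp B.1) : pseudoExpectation Γ C = Γ A B := by
  obtain ⟨P, z, hz, hz4⟩ := exists_pauliOp_mul A B
  have hex := exists_pauliOp_factorization P
  have hch := hex.choose_spec
  have hmom : pauliMoment Γ P.1 = Γ hex.choose.1 hex.choose.2 := by
    rw [pauliMoment, dif_pos hex]
  have htr := trace_pauliOp_mul P.1 P.1
  rw [if_pos rfl] at htr
  have hne : pauliOp P.1 ≠ 0 := by
    intro h0
    rw [h0, zero_mul, Matrix.trace_zero] at htr
    exact pow_ne_zero _ (two_ne_zero) htr.symm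
  have hherm := isHermitian_of_mem_pauliSpan hC
  rw [hAB, hz, Matrix.IsHermitian, Matrix.conjTranspose_smul, (pauliOp_isHermitian P.1).eq] at hherm
  have hzr : star z = z := smul_left_injective ℂ hne hherm
  obtain ⟨r, rfl⟩ := Complex.conj_eq_iff_real.mp hzr
  have hr4 : r ^ 4 = 1 := by exact_mod_cast hz4
  have hr : r = 1 ∨ r = -1 := by
    have : (r - 1) * (r + 1) * (r ^ 2 + 1) = 0 := by linear_combination hr4
    rcases mul_eq_zero.mp this with h | h
    · rcases mul_eq_zero.mp h with h | h
      · left; linarith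
      · right; linarith
    · nlinarith [sq_nonneg r]
  have hL := pseudoExpectation_pauliOp Γ P
  rcases hr with rfl | rfl
  · have hz' : pauliOp A.1 * pauliOp B.1 = pauliOp P.1 := by simpa using hz
    rw [hAB, hz', hL, hmom]
    exact hΓ.eq_of_mul_eq _ _ _ _ (hch.trans hz'.symm)
  · have hz' : pauliOp A.1 * pauliOp B.1 = -pauliOp P.1 := by simpa using hz
    have hneg : -pauliOp P.1 = (-1 : ℝ) • pauliOp P.1 := by simp
    rw [hAB, hz', hneg, pseudoExpectation_smul, hL, hmom,
      hΓ.eq_neg_of_mul_eq_neg A B _ _ (hz'.trans (congrArg Neg.neg hch.symm))]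
    ring

/-- The value `g_ij = (-1 + L(X_i X_j) - L(Y_i Y_j) + L(Z_i Z_j)) / 2` of a moment matrix. -/
noncomputable def momentValue {V : Type*} [Fintype V] [DecidableEq V] {k : ℕ}
    (Γ : Matrix (PauliMonomial V k) (PauliMonomial V k) ℝ) (i j : V) : ℝ :=
  (-1 + pseudoExpectation Γ (siteOp .X i * siteOp .X j)
    - pseudoExpectation Γ (siteOp .Y i * siteOp .Y j)
    + pseudoExpectation Γ (siteOp .Z i * siteOp .Z j)) / 2

/-- `Γ` is an optimal solution of the level-`k` semidefinite program
`max L(H(G))` subject to `Γ ∈ ℳₖ`. -/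
def IsMomentSoSSolution {V : Type*} [Fintype V] [DecidableEq V] (G : SimpleGraph V)
    [DecidableRel G.Adj] (w : Sym2 V → ℝ) {k : ℕ}
    (Γ : Matrix (PauliMonomial V k) (PauliMonomial V k) ℝ) : Prop :=
  IsMomentMatrix Γ ∧ ∀ Γ' : Matrix (PauliMonomial V k) (PauliMonomial V k) ℝ, IsMomentMatrix Γ' →
    pseudoExpectation Γ' (eprHamiltonian G w) ≤ pseudoExpectation Γ (eprHamiltonian G w)

/-! ### The bound -/

/-- The nonlinear monogamy bound for edge values `g` on the star around `i` with the
distinguished neighbour `j`: the value `g_ij` lies in `[-1, 1]`, and the sum of the values on the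
other edges at `i` is bounded by the piecewise function of `g_ij`. -/
def StarMonogamyBound {V : Type*} [Fintype V] [DecidableEq V] (G : SimpleGraph V)
    [DecidableRel G.Adj] (g : V → V → ℝ) (i j : V) : Prop :=
  -1 ≤ g i j ∧ g i j ≤ 1 ∧
    ∑ k ∈ (G.neighborFinset i).erase j, g i k ≤
      if g i j < -1 / (G.degree i : ℝ) then 1
      else (1 / 2) * (2 - (G.degree i : ℝ) - g i j
        + Real.sqrt (((G.degree i : ℝ) ^ 2 - 1) * (1 - g i j ^ 2)))

/-! The bound concerns the Gram vectors of a moment matrix, a state being the special case of its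
own moment matrix. Conjugation by `Y` at the centre `i` of the star turns `I - h_ik` into the
operator that swaps the qubits `i` and `k`, so the claim is about expectation values of swaps. Let
`e` be the vector of the identity and, for a set `N` of `n` leaves, put `A = (i j)`,
`P = ∑ (i k) - ∑ (j k)` and `W = (i j) + ∑ (i k) + ∑ (j k) - (n - 1)`, with `k` ranging over `N`.
As operators, `A W = W` and `W P = 0`, while `P` anticommutes with `A`; this gives `A ⊥ P`, `W ⊥ P`
and `⟪A, W⟫ = ⟪e, W⟫`. Moreover `‖P‖ ^ 2 + ‖W‖ ^ 2 ≤ n * (n + 2) + 2 * ⟪e, W⟫`, because three qubits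
have no antisymmetric state. Let `a = ⟪e, A⟫` and `γ ^ 2 * (n * (n + 2)) = 1 - a ^ 2`. Expanding
`0 ≤ ‖e - a • A + t • W + γ • P‖ ^ 2`, where `t = γ * (1 - γ) / (1 - a)` makes the terms in
`⟪e, W⟫` combine with `⟪e, P⟫`, gives the ellipse in the theorem. -/

section InnerProductSpace

open scoped RealInnerProductSpace

open scoped ComplexOrder MatrixOrder in
theorem exists_eq_gram_of_posSemidef {𝕜 n : Type*} [RCLike 𝕜] [Fintype n]
    {M : Matrix n n 𝕜} (hM : M.PosSemidef) :
    ∃ x : n → EuclideanSpace 𝕜 n, M = Matrix.gram 𝕜 x := by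
  classical
  obtain ⟨B, rfl⟩ : ∃ B : Matrix n n 𝕜, M = star B * B :=
    CStarAlgebra.nonneg_iff_eq_star_mul_self.mp (Matrix.nonneg_iff_posSemidef.mpr hM)
  refine ⟨fun k => WithLp.toLp 2 (B.col k), ?_⟩
  ext k l
  simp [Matrix.mul_apply, PiLp.inner_apply, mul_comm]

variable {E : Type*} [NormedAddCommGroup E] [InnerProductSpace ℝ E]

theorem neg_inner_add_mul_le_of_norm_sq_add_le {e A P W : E} {c γ : ℝ} (he : ‖e‖ = 1)
    (hA : ‖A‖ = 1) (hAP : ⟪A, P⟫ = 0) (hWP : ⟪W, P⟫ = 0) (hAW : ⟪A, W⟫ = ⟪e, W⟫)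
    (hPW : ‖P‖ ^ 2 + ‖W‖ ^ 2 ≤ c + 2 * ⟪e, W⟫) (hγA : ⟪e, A⟫ ≤ γ) (hγ1 : γ ≤ 1)
    (hγ : γ ^ 2 * c = 1 - ⟪e, A⟫ ^ 2) : -⟪e, P + W⟫ * γ ≤ γ ^ 2 * c := by
  set a := ⟪e, A⟫ with ha
  set s := (1 - γ) / (1 - a)
  have hs : s * (1 - a) = 1 - γ := div_mul_cancel_of_imp fun h => by linarith
  have hs1 : s ^ 2 ≤ 1 :=
    pow_le_one₀ (div_nonneg (by linarith) (by linarith))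
      (div_le_one_of_le₀ (by linarith) (by linarith))
  set v := e - a • A + (s * γ) • W with hv
  have hvP : ⟪v, P⟫ = ⟪e, P⟫ := by
    simp only [hv, inner_add_left, inner_sub_left, real_inner_smul_left, hAP, hWP]
    ring
  have hvv : ‖v‖ ^ 2 = 1 - a ^ 2 + 2 * γ * (1 - γ) * ⟪e, W⟫ + s ^ 2 * γ ^ 2 * ‖W‖ ^ 2 := by
    rw [hv, norm_add_sq_real, norm_sub_sq_real, inner_sub_left, norm_smul, norm_smul, mul_pow,
      mul_pow, Real.norm_eq_abs, Real.norm_eq_abs, sq_abs, sq_abs, he, hA]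
    simp only [real_inner_smul_left, real_inner_smul_right, hAW, ← ha]
    linear_combination 2 * γ * ⟪e, W⟫ * hs
  have hexp : ‖v + γ • P‖ ^ 2 = ‖v‖ ^ 2 + 2 * γ * ⟪e, P⟫ + γ ^ 2 * ‖P‖ ^ 2 := by
    rw [norm_add_sq_real, real_inner_smul_right, hvP, norm_smul, mul_pow, Real.norm_eq_abs, sq_abs]
    ring
  have hW : 0 ≤ (1 - s ^ 2) * (γ ^ 2 * ‖W‖ ^ 2) := mul_nonneg (by linarith) (by positivity)
  have hP : γ ^ 2 * (‖P‖ ^ 2 + ‖W‖ ^ 2) ≤ γ ^ 2 * (c + 2 * ⟪e, W⟫) := by gcongr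
  rw [inner_add_right]
  linarith [sq_nonneg ‖v + γ • P‖]

theorem neg_inner_add_le_sqrt_of_norm_sq_add_le {e A P W : E} {d : ℝ} (he : ‖e‖ = 1)
    (hA : ‖A‖ = 1) (hAP : ⟪A, P⟫ = 0) (hWP : ⟪W, P⟫ = 0) (hAW : ⟪A, W⟫ = ⟪e, W⟫)
    (hPW : ‖P‖ ^ 2 + ‖W‖ ^ 2 ≤ d ^ 2 - 1 + 2 * ⟪e, W⟫) (hd : 2 ≤ d) (hdA : d * ⟪e, A⟫ ≤ 1) :
    -⟪e, P + W⟫ ≤ √((d ^ 2 - 1) * (1 - ⟪e, A⟫ ^ 2)) := by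
  have hc : 1 ≤ d ^ 2 - 1 := by nlinarith
  have hA1 : |⟪e, A⟫| ≤ 1 := by simpa [he, hA] using abs_real_inner_le_norm e A
  rcases (neg_le_of_abs_le hA1).eq_or_lt with hopp | hlt
  · have heA : e = -A := (inner_eq_neg_one_iff_of_norm_eq_one he hA).mp hopp.symm
    have hW : ⟪A, W⟫ = 0 := by
      rw [heA, inner_neg_left] at hAW
      linarith
    rw [heA, inner_neg_left, inner_add_right, hAP, hW]
    simp
  set γ := √((1 - ⟪e, A⟫ ^ 2) / (d ^ 2 - 1)) with hγdef
  have hpos : 0 < 1 - ⟪e, A⟫ ^ 2 := by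
    nlinarith [show ⟪e, A⟫ < 1 by nlinarith]
  have hγ0 : 0 < γ := Real.sqrt_pos.mpr (by positivity)
  have hγ : γ ^ 2 * (d ^ 2 - 1) = 1 - ⟪e, A⟫ ^ 2 := by
    rw [hγdef, Real.sq_sqrt (by positivity), div_mul_cancel₀ _ (by positivity)]
  have hγ1 : γ ≤ 1 :=
    Real.sqrt_le_one.mpr <| (div_le_one (by positivity)).mpr <| by nlinarith [sq_nonneg ⟪e, A⟫]
  have hγA : ⟪e, A⟫ ≤ γ := by
    rcases le_total ⟪e, A⟫ 0 with hneg | hnonneg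
    · exact hneg.trans hγ0.le
    · have hdA2 : (d * ⟪e, A⟫) ^ 2 ≤ 1 := pow_le_one₀ (by positivity) hdA
      exact Real.le_sqrt_of_sq_le ((le_div_iff₀ (by positivity)).mpr (by linarith))
  have hsqrt : √((d ^ 2 - 1) * (1 - ⟪e, A⟫ ^ 2)) = γ * (d ^ 2 - 1) := by
    rw [← hγ, Real.sqrt_eq_iff_mul_self_eq_of_pos (by positivity)]
    ring
  have htangent := neg_inner_add_mul_le_of_norm_sq_add_le he hA hAP hWP hAW hPW hγA hγ1 hγ
  rw [hsqrt]
  exact le_of_mul_le_mul_right (htangent.trans_eq (by ring)) hγ0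

/-- The Gram vectors of the qubit swaps in a (pseudo-)state: `e` is the vector of the identity and
`S s(a, b)` that of the swap of the qubits `a` and `b`. The values of `S` on the diagonal are
arbitrary. The field `triangle` is the vanishing of the antisymmetrizer on three qubits: the
anticommutator of `(a b)` and `(a c)` is the sum of the two 3-cycles, hence equal to
`(a b) + (a c) + (b c) - 1`. -/
structure IsSwapSystem {V : Type*} (e : E) (S : Sym2 V → E) : Prop where
  norm_ref : ‖e‖ = 1
  norm_swap : ∀ z, ¬ z.IsDiag → ‖S z‖ = 1
  triangle : ∀ a b c, a ≠ b → a ≠ c → b ≠ c →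
    2 * ⟪S s(a, b), S s(a, c)⟫ = ⟪e, S s(a, b)⟫ + ⟪e, S s(a, c)⟫ + ⟪e, S s(b, c)⟫ - 1

namespace IsSwapSystem

variable {V : Type*} {e : E} {S : Sym2 V → E} {i j : V} {N : Finset V}

/-- The sum of the swaps along the edges of the star with centre `i` and leaves `N`. -/
noncomputable def starSum (S : Sym2 V → E) (i : V) (N : Finset V) : E :=
  ∑ k ∈ N, S s(i, k)

/-- The part `P` of the star sums over `N` that is antisymmetric under the exchange of the centres
`i` and `j`. -/
noncomputable def starDiff (S : Sym2 V → E) (i j : V) (N : Finset V) : E :=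
  starSum S i N - starSum S j N

/-- The part `W` of the star sums over `N` that is symmetric under the exchange of the centres `i`
and `j`, completed by the swap of `i` and `j` and by a multiple of `e` so that its inner products
with `e` and with that swap agree. -/
noncomputable def starTotal (e : E) (S : Sym2 V → E) (i j : V) (N : Finset V) : E :=
  S s(i, j) + (starSum S i N + starSum S j N) - ((N.card : ℝ) - 1) • e

/-- How far the swaps within `N` are, in total, from their largest value `1`; each unordered pair is
counted twice, with weight `1 / 2`. -/
noncomputable def swapDefect [DecidableEq V] (e : E) (S : Sym2 V → E) (N : Finset V) : ℝ :=
  ∑ k ∈ N, ∑ l ∈ N, if k = l then 0 else (1 - ⟪e, S s(k, l)⟫) / 2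

theorem abs_inner_le_one (h : IsSwapSystem e S) {z : Sym2 V} (hz : ¬ z.IsDiag) :
    |⟪e, S z⟫| ≤ 1 := by
  simpa [h.norm_ref, h.norm_swap z hz] using abs_real_inner_le_norm e (S z)

theorem swapDefect_nonneg [DecidableEq V] (h : IsSwapSystem e S) (N : Finset V) :
    0 ≤ swapDefect e S N := by
  refine Finset.sum_nonneg fun k _ => Finset.sum_nonneg fun l _ => ?_
  split_ifs with hkl
  · exact le_rfl
  · linarith [le_of_abs_le (h.abs_inner_le_one (z := s(k, l)) hkl)]

theorem norm_sq_starSum [DecidableEq V] (h : IsSwapSystem e S) (hi : i ∉ N) :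
    ‖starSum S i N‖ ^ 2 =
      N.card + ((N.card : ℝ) - 1) * ⟪e, starSum S i N⟫ - swapDefect e S N := by
  have hterm : ∀ k ∈ N, ∀ l ∈ N, ⟪S s(i, k), S s(i, l)⟫ =
      ⟪e, S s(i, k)⟫ / 2 + ⟪e, S s(i, l)⟫ / 2
        - (if k = l then 0 else (1 - ⟪e, S s(k, l)⟫) / 2)
        + if k = l then 1 - ⟪e, S s(i, k)⟫ else 0 := by
    intro k hk l hl
    have hik : i ≠ k := (ne_of_mem_of_not_mem hk hi).symm
    have hil : i ≠ l := (ne_of_mem_of_not_mem hl hi).symm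
    split_ifs with hkl
    · rw [← hkl, real_inner_self_eq_norm_sq, h.norm_swap s(i, k) hik]
      ring
    · linarith [h.triangle i k l hik hil hkl]
  rw [← real_inner_self_eq_norm_sq, starSum, swapDefect, sum_inner]
  simp only [inner_sum]
  rw [Finset.sum_congr rfl fun k hk => Finset.sum_congr rfl (hterm k hk)]
  simp only [Finset.sum_add_distrib, Finset.sum_sub_distrib, Finset.sum_const, nsmul_eq_mul,
    ← Finset.sum_div, ← Finset.mul_sum, Finset.sum_ite_eq, Finset.sum_ite_mem, Finset.inter_self]
  ring

theorem two_mul_inner_starSum (h : IsSwapSystem e S) (hij : i ≠ j) (hi : i ∉ N) (hj : j ∉ N) :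
    2 * ⟪S s(i, j), starSum S i N⟫ =
      N.card * (⟪e, S s(i, j)⟫ - 1) + ⟪e, starSum S i N⟫ + ⟪e, starSum S j N⟫ := by
  have hterm : ∀ k ∈ N, 2 * ⟪S s(i, j), S s(i, k)⟫ =
      ⟪e, S s(i, j)⟫ - 1 + ⟪e, S s(i, k)⟫ + ⟪e, S s(j, k)⟫ := fun k hk => by
    linarith [h.triangle i j k hij (ne_of_mem_of_not_mem hk hi).symm
      (ne_of_mem_of_not_mem hk hj).symm]
  simp only [starSum, inner_sum, Finset.mul_sum]
  rw [Finset.sum_congr rfl hterm]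
  simp only [Finset.sum_add_distrib, Finset.sum_const, nsmul_eq_mul]

theorem neg_one_le_inner_starSum (h : IsSwapSystem e S) (hi : i ∉ N) :
    -1 ≤ ⟪e, starSum S i N⟫ := by
  classical
  set b := ⟪e, starSum S i N⟫
  have hcs : |b| ≤ ‖starSum S i N‖ := by
    simpa [h.norm_ref] using abs_real_inner_le_norm e (starSum S i N)
  have hquad : (b + 1) * (b - N.card) ≤ 0 := by
    have := sq_le_sq₀ (abs_nonneg b) (norm_nonneg _) |>.mpr hcs
    rw [sq_abs, h.norm_sq_starSum hi] at this
    linarith [h.swapDefect_nonneg N]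
  by_contra! hlt
  nlinarith [mul_pos_of_neg_of_neg (show b + 1 < 0 by linarith) 
    (show b - N.card < 0 by linarith [N.card.cast_nonneg (α := ℝ)])]

theorem inner_starSum_left_eq_right (h : IsSwapSystem e S) (hij : i ≠ j) (hi : i ∉ N)
    (hj : j ∉ N) : ⟪S s(i, j), starSum S i N⟫ = ⟪S s(i, j), starSum S j N⟫ := by
  have hji := h.two_mul_inner_starSum hij.symm hj hi
  rw [Sym2.eq_swap] at hji
  linarith [h.two_mul_inner_starSum hij hi hj]

theorem inner_starDiff (h : IsSwapSystem e S) (hij : i ≠ j) (hi : i ∉ N) (hj : j ∉ N) :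
    ⟪S s(i, j), starDiff S i j N⟫ = 0 := by
  rw [starDiff, inner_sub_right, h.inner_starSum_left_eq_right hij hi hj, sub_self]

theorem inner_starTotal (h : IsSwapSystem e S) (hij : i ≠ j) (hi : i ∉ N) (hj : j ∉ N) :
    ⟪S s(i, j), starTotal e S i j N⟫ = ⟪e, starTotal e S i j N⟫ := by
  simp only [starTotal, inner_add_right, inner_sub_right, real_inner_smul_right,
    real_inner_self_eq_norm_sq, h.norm_ref, h.norm_swap s(i, j) hij, real_inner_comm e,
    ← h.inner_starSum_left_eq_right hij hi hj]
  linarith [h.two_mul_inner_starSum hij hi hj]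

theorem inner_starTotal_starDiff (h : IsSwapSystem e S) (hij : i ≠ j) (hi : i ∉ N) (hj : j ∉ N) :
    ⟪starTotal e S i j N, starDiff S i j N⟫ = 0 := by
  classical
  have hsum : ⟪starSum S i N + starSum S j N, starDiff S i j N⟫ =
      ((N.card : ℝ) - 1) * ⟪e, starDiff S i j N⟫ := by
    rw [starDiff, inner_add_left, inner_sub_right, inner_sub_right, inner_sub_right,
      real_inner_self_eq_norm_sq, real_inner_self_eq_norm_sq, h.norm_sq_starSum hi,
      h.norm_sq_starSum hj, real_inner_comm (starSum S j N)]
    ring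
  rw [starTotal, inner_sub_left, inner_add_left, hsum, h.inner_starDiff hij hi hj,
    real_inner_smul_left]
  ring

theorem norm_sq_starDiff_add_norm_sq_starTotal_le (h : IsSwapSystem e S) (hij : i ≠ j)
    (hi : i ∉ N) (hj : j ∉ N) :
    ‖starDiff S i j N‖ ^ 2 + ‖starTotal e S i j N‖ ^ 2 ≤
      ((N.card : ℝ) + 1) ^ 2 - 1 + 2 * ⟪e, starTotal e S i j N⟫ := by
  classical
  have hdefect := h.swapDefect_nonneg N
  have hinner := h.two_mul_inner_starSum hij hi hj
  have hpar := parallelogram_law_with_norm ℝ (starSum S i N) (starSum S j N)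
  simp only [h.norm_sq_starSum hi, h.norm_sq_starSum hj] at hpar
  have htotal : ‖starTotal e S i j N‖ ^ 2 =
      1 + 4 * ⟪S s(i, j), starSum S i N⟫ + ‖starSum S i N + starSum S j N‖ ^ 2
        - 2 * ((N.card : ℝ) - 1) *
          (⟪e, S s(i, j)⟫ + ⟪e, starSum S i N⟫ + ⟪e, starSum S j N⟫)
        + ((N.card : ℝ) - 1) ^ 2 := by
    rw [starTotal, norm_sub_sq_real, norm_add_sq_real, inner_add_right (S s(i, j)),
      ← h.inner_starSum_left_eq_right hij hi hj, real_inner_smul_right, inner_add_left,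
      inner_add_left, norm_smul, mul_pow, Real.norm_eq_abs, sq_abs, h.norm_ref,
      h.norm_swap s(i, j) hij]
    simp only [real_inner_comm e]
    ring
  have href : ⟪e, starTotal e S i j N⟫ =
      ⟪e, S s(i, j)⟫ + ⟪e, starSum S i N⟫ + ⟪e, starSum S j N⟫ - ((N.card : ℝ) - 1) := by
    simp only [starTotal, inner_sub_right, inner_add_right, real_inner_smul_right,
      real_inner_self_eq_norm_sq, h.norm_ref]
    ring
  rw [htotal, href, starDiff]
  linarith

theorem neg_inner_starSum_le (h : IsSwapSystem e S) (hij : i ≠ j) (hi : i ∉ N) (hj : j ∉ N)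
    (ha : ((N.card : ℝ) + 1) * ⟪e, S s(i, j)⟫ ≤ 1) :
    -⟪e, starSum S i N⟫ ≤ 1 / 2 * (1 - N.card + ⟪e, S s(i, j)⟫
      + √((((N.card : ℝ) + 1) ^ 2 - 1) * (1 - ⟪e, S s(i, j)⟫ ^ 2))) := by
  rcases N.eq_empty_or_nonempty with rfl | hN
  · have := neg_le_of_abs_le (h.abs_inner_le_one (z := s(i, j)) hij)
    simp only [starSum, Finset.sum_empty, inner_zero_right, Finset.card_empty, Nat.cast_zero,
      zero_add, one_pow, sub_self, zero_mul, Real.sqrt_zero]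
    linarith
  have hcard : (1 : ℝ) ≤ N.card := by exact_mod_cast hN.card_pos
  have hsum : ⟪e, starDiff S i j N + starTotal e S i j N⟫ =
      ⟪e, S s(i, j)⟫ + 2 * ⟪e, starSum S i N⟫ - (N.card - 1) := by
    simp only [starDiff, starTotal, inner_add_right, inner_sub_right, real_inner_smul_right,
      real_inner_self_eq_norm_sq, h.norm_ref]
    ring
  have hbound := neg_inner_add_le_sqrt_of_norm_sq_add_le h.norm_ref (h.norm_swap s(i, j) hij)
    (h.inner_starDiff hij hi hj) (h.inner_starTotal_starDiff hij hi hj)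
    (h.inner_starTotal hij hi hj) (h.norm_sq_starDiff_add_norm_sq_starTotal_le hij hi hj)
    (by linarith) ha
  rw [hsum] at hbound
  linarith

theorem starMonogamyBound [Fintype V] [DecidableEq V] (h : IsSwapSystem e S) {G : SimpleGraph V}
    [DecidableRel G.Adj] (hij : G.Adj i j) :
    StarMonogamyBound G (fun a b => -⟪e, S s(a, b)⟫) i j := by
  set N := (G.neighborFinset i).erase j with hN
  have hi : i ∉ N := by simp [hN]
  have hj : j ∉ N := Finset.notMem_erase j _
  have hdeg : (G.degree i : ℝ) = N.card + 1 := by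
    rw [← G.card_neighborFinset_eq_degree,
      ← Finset.card_erase_add_one (a := j) (by simpa using hij)]
    push_cast
    rfl
  have habs := abs_le.mp (h.abs_inner_le_one (z := s(i, j)) hij.ne)
  have hsum : ∑ k ∈ N, -⟪e, S s(i, k)⟫ = -⟪e, starSum S i N⟫ := by
    rw [starSum, inner_sum, Finset.sum_neg_distrib]
  refine ⟨by linarith, by linarith, ?_⟩
  simp only [← hN, hsum, neg_sq]
  split_ifs with hlt
  · linarith [h.neg_one_le_inner_starSum hi]
  · rw [not_lt, hdeg, div_le_iff₀ (by positivity)] at hlt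
    rw [hdeg]
    refine (h.neg_inner_starSum_le hij.ne hi hj (by linarith)).trans_eq ?_
    ring

end IsSwapSystem

end InnerProductSpace

theorem starMonogamyBound_congr {V : Type*} [Fintype V] [DecidableEq V] {G : SimpleGraph V}
    [DecidableRel G.Adj] {g g' : V → V → ℝ} {i j : V} (hij : G.Adj i j)
    (h : ∀ k, G.Adj i k → g i k = g' i k) :
    StarMonogamyBound G g i j ↔ StarMonogamyBound G g' i j := by
  have hsum : ∑ k ∈ (G.neighborFinset i).erase j, g i k =
      ∑ k ∈ (G.neighborFinset i).erase j, g' i k :=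
    Finset.sum_congr rfl fun k hk => h k (by simpa using Finset.mem_of_mem_erase hk)
  rw [StarMonogamyBound, StarMonogamyBound, hsum, h j hij]

section PauliStrings

variable {V : Type*}

section Edges

variable [DecidableEq V]

/-- The Pauli string with label `p` on the endpoints of `z` and the identity elsewhere. -/
def edgeString (p : PauliLabel) (z : Sym2 V) : V → PauliLabel :=
  fun v => if v ∈ z then p else .I

/-- The sign that `X X` and `Z Z` on the pair `z` acquire under conjugation by `Y` at `i`, for `z`
off the diagonal. -/
def edgeSign (i : V) (z : Sym2 V) : ℝ :=
  if i ∈ z then -1 else 1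

theorem edgeSign_mul_self (i : V) (z : Sym2 V) : edgeSign i z * edgeSign i z = 1 := by
  rw [edgeSign]
  split_ifs <;> norm_num

theorem edgeSign_mul_of_adjacent (i : V) {a b c : V} (hab : a ≠ b) (hac : a ≠ c) (hbc : b ≠ c) :
    edgeSign i s(a, b) * edgeSign i s(a, c) = edgeSign i s(b, c) := by
  by_cases hia : i = a <;> by_cases hib : i = b <;> by_cases hic : i = c <;>
    simp_all [edgeSign]

end Edges

theorem PauliLabel.mat_I : PauliLabel.I.mat = 1 := Matrix.one_fin_two.symm

theorem PauliLabel.mat_mul_self (a : PauliLabel) : a.mat * a.mat = 1 := by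
  cases a <;> simp [PauliLabel.mat, Matrix.one_fin_two]

theorem PauliLabel.mat_X_mul_mat_Y :
    PauliLabel.X.mat * PauliLabel.Y.mat = Complex.I • PauliLabel.Z.mat := by
  simp [PauliLabel.mat]

theorem PauliLabel.mat_Y_mul_mat_Z :
    PauliLabel.Y.mat * PauliLabel.Z.mat = Complex.I • PauliLabel.X.mat := by
  simp [PauliLabel.mat]

theorem PauliLabel.mat_Z_mul_mat_X :
    PauliLabel.Z.mat * PauliLabel.X.mat = Complex.I • PauliLabel.Y.mat := by
  simp [PauliLabel.mat]

/-- The sign `ε` with `a b = ε b a` for the Pauli matrices with labels `a` and `b`. -/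
def PauliLabel.commSign (a b : PauliLabel) : ℤˣ :=
  if a = .I ∨ b = .I ∨ a = b then 1 else -1

theorem PauliLabel.mat_mul_mat_comm (a b : PauliLabel) :
    a.mat * b.mat = ((a.commSign b : ℤ) : ℂ) • (b.mat * a.mat) := by
  cases a <;> cases b <;> simp [PauliLabel.mat, PauliLabel.commSign]

variable [Fintype V]

theorem qubitTensor_smul (z : V → ℂ) (M : V → Matrix (Fin 2) (Fin 2) ℂ) :
    qubitTensor (fun v => z v • M v) = (∏ v, z v) • qubitTensor M := by
  ext x y
  simp [qubitTensor, Finset.prod_mul_distrib]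

theorem pauliOp_I : pauliOp (fun _ : V => PauliLabel.I) = 1 := by
  ext x y
  simp only [pauliOp, qubitTensor, PauliLabel.mat_I, Matrix.of_apply, Matrix.one_apply,
    Finset.prod_ite_zero, Finset.prod_const_one, Finset.mem_univ, true_implies, funext_iff]

/-- The sign `ε` with `s t = ε t s` for the Pauli strings `s` and `t`. -/
def pauliCommSign (s t : V → PauliLabel) : ℤˣ :=
  ∏ v, (s v).commSign (t v)

variable [DecidableEq V]

theorem pauliOp_mul_self (s : V → PauliLabel) : pauliOp s * pauliOp s = 1 := by
  simp only [← pauliOp_I, pauliOp, qubitTensor_mul, PauliLabel.mat_mul_self, PauliLabel.mat_I]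

theorem pauliOp_mul_comm (s t : V → PauliLabel) :
    pauliOp s * pauliOp t = ((pauliCommSign s t : ℤ) : ℂ) • (pauliOp t * pauliOp s) := by
  simp only [pauliOp, qubitTensor_mul, PauliLabel.mat_mul_mat_comm (s _), qubitTensor_smul]
  simp [pauliCommSign]

theorem conjTranspose_pauliOp_mul (s t : V → PauliLabel) :
    (pauliOp s * pauliOp t).conjTranspose = pauliOp t * pauliOp s := by
  rw [Matrix.conjTranspose_mul, (pauliOp_isHermitian s).eq, (pauliOp_isHermitian t).eq]

theorem isHermitian_pauliOp_mul_iff {s t : V → PauliLabel} :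
    (pauliOp s * pauliOp t).IsHermitian ↔ pauliCommSign s t = 1 := by
  have hunit : (pauliOp t * pauliOp s) * (pauliOp s * pauliOp t) = 1 := by
    rw [mul_assoc, ← mul_assoc (pauliOp s), pauliOp_mul_self, one_mul, pauliOp_mul_self]
  rw [Matrix.IsHermitian, conjTranspose_pauliOp_mul, pauliOp_mul_comm s t]
  rcases Int.units_eq_one_or (pauliCommSign s t) with hε | hε
  · simp [hε]
  · suffices pauliOp t * pauliOp s ≠ -(pauliOp t * pauliOp s) by simpa [hε]
    intro hneg
    have h0 : pauliOp t * pauliOp s = 0 := by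
      ext x y
      exact self_eq_neg.mp (congrFun₂ hneg x y)
    rw [h0, zero_mul] at hunit
    exact zero_ne_one hunit

theorem siteOp_mul_siteOp (p : PauliLabel) {a b : V} (hab : a ≠ b) :
    siteOp p a * siteOp p b = pauliOp (edgeString p s(a, b)) := by
  simp only [siteOp, pauliOp, qubitTensor_mul]
  congr 1
  funext v
  by_cases hva : v = a <;> by_cases hvb : v = b <;>
    simp_all [edgeString, PauliLabel.mat_I]

theorem pauliOp_edgeString_mul_of_adjacent (p : PauliLabel) {a b c : V} (hab : a ≠ b)
    (hac : a ≠ c) (hbc : b ≠ c) :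
    pauliOp (edgeString p s(a, b)) * pauliOp (edgeString p s(a, c)) =
      pauliOp (edgeString p s(b, c)) := by
  simp only [pauliOp, qubitTensor_mul]
  congr 1
  funext v
  by_cases hva : v = a <;> by_cases hvb : v = b <;> by_cases hvc : v = c <;>
    simp_all [edgeString, PauliLabel.mat_I, PauliLabel.mat_mul_self]

theorem pauliOp_edgeString_mul_of_mat_mul {p q r : PauliLabel} {ζ : ℂ}
    (h : p.mat * q.mat = ζ • r.mat) {z : Sym2 V} (hz : ¬ z.IsDiag) :
    pauliOp (edgeString p z) * pauliOp (edgeString q z) = ζ ^ 2 • pauliOp (edgeString r z) := by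
  have hsite : ∀ v, (edgeString p z v).mat * (edgeString q z v).mat =
      (if v ∈ z.toFinset then ζ else 1) • (edgeString r z v).mat := fun v => by
    by_cases hv : v ∈ z <;> simp [edgeString, hv, h, PauliLabel.mat_I]
  simp only [pauliOp, qubitTensor_mul, hsite, qubitTensor_smul, Fintype.prod_ite_mem,
    Finset.prod_const, Sym2.card_toFinset_of_not_isDiag z hz]

theorem pauliCommSign_edgeString_of_adjacent {p q : PauliLabel} (hp : p ≠ .I) (hq : q ≠ .I)
    (hpq : p ≠ q) {a b c : V} (hbc : b ≠ c) :
    pauliCommSign (edgeString p s(a, b)) (edgeString q s(a, c)) = -1 := by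
  rw [pauliCommSign, Finset.prod_eq_single a]
  · simp [edgeString, PauliLabel.commSign, hp, hq, hpq]
  · intro v _ hva
    have hv : v ≠ b ∨ v ≠ c := by
      by_contra! hv
      exact hbc (hv.1.symm.trans hv.2)
    rcases hv with hv | hv <;> simp [edgeString, PauliLabel.commSign, hva, hv]
  · simp

/-- The string `edgeString p z` as an element of `𝒫ₖ`. -/
def edgeMonomial {k : ℕ} (hk : 2 ≤ k) (p : PauliLabel) (z : Sym2 V) : PauliMonomial V k :=
  ⟨edgeString p z, by
    refine le_trans (Finset.card_le_card (t := z.toFinset) fun v hv => ?_) (le_trans ?_ hk)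
    · by_contra hvz
      simp_all [edgeString]
    · rw [Sym2.card_toFinset]
      split_ifs <;> simp⟩

/-- The identity string as an element of `𝒫ₖ`. -/
def oneMonomial (V : Type*) [Fintype V] (k : ℕ) : PauliMonomial V k :=
  ⟨fun _ => .I, by simp⟩

end PauliStrings

namespace IsMomentMatrix

open scoped RealInnerProductSpace

variable {V : Type*} [Fintype V] [DecidableEq V] {k : ℕ}
  {Γ : Matrix (PauliMonomial V k) (PauliMonomial V k) ℝ}

theorem apply_edgeMonomial_of_adjacent (h : IsMomentMatrix Γ) (hk : 2 ≤ k) (p : PauliLabel)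
    {a b c : V} (hab : a ≠ b) (hac : a ≠ c) (hbc : b ≠ c) :
    Γ (edgeMonomial hk p s(a, b)) (edgeMonomial hk p s(a, c)) =
      Γ (oneMonomial V k) (edgeMonomial hk p s(b, c)) := by
  apply h.eq_of_mul_eq
  simpa only [edgeMonomial, oneMonomial, pauliOp_I, one_mul] using
    pauliOp_edgeString_mul_of_adjacent p hab hac hbc

theorem apply_edgeMonomial_of_adjacent_of_ne (h : IsMomentMatrix Γ) (hk : 2 ≤ k)
    {p q : PauliLabel} (hp : p ≠ .I) (hq : q ≠ .I) (hpq : p ≠ q) {a b c : V} (hbc : b ≠ c) :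
    Γ (edgeMonomial hk p s(a, b)) (edgeMonomial hk q s(a, c)) = 0 := by
  apply h.eq_zero
  rw [isHermitian_pauliOp_mul_iff, edgeMonomial, edgeMonomial,
    pauliCommSign_edgeString_of_adjacent hp hq hpq hbc]
  decide

theorem apply_edgeMonomial_of_mat_mul (h : IsMomentMatrix Γ) (hk : 2 ≤ k) {p q r : PauliLabel}
    (hpqr : p.mat * q.mat = Complex.I • r.mat) {z : Sym2 V} (hz : ¬ z.IsDiag) :
    Γ (edgeMonomial hk p z) (edgeMonomial hk q z) =
      -Γ (oneMonomial V k) (edgeMonomial hk r z) := by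
  apply h.eq_neg_of_mul_eq_neg
  simpa only [edgeMonomial, oneMonomial, pauliOp_I, one_mul, Complex.I_sq, neg_one_smul] using
    pauliOp_edgeString_mul_of_mat_mul hpqr hz

theorem pseudoExpectation_siteOp_mul_siteOp (h : IsMomentMatrix Γ) (hk : 2 ≤ k) (p : PauliLabel)
    {a b : V} (hab : a ≠ b) :
    pseudoExpectation Γ (siteOp p a * siteOp p b) =
      Γ (oneMonomial V k) (edgeMonomial hk p s(a, b)) := by
  rw [siteOp_mul_siteOp p hab]
  refine pseudoExpectation_eq h (Submodule.subset_span ?_) _ _ ?_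
  · exact ⟨edgeMonomial (by omega) p s(a, b), rfl⟩
  · simp only [edgeMonomial, oneMonomial, pauliOp_I, one_mul]

variable {E : Type*} [NormedAddCommGroup E] [InnerProductSpace ℝ E] {x : PauliMonomial V k → E}

/-- The combination of the Gram vectors `x` of a moment matrix that represents the swap
`(I + X X + Y Y + Z Z) / 2` on the pair `z`, conjugated by `Y` at the qubit `i`. The conjugation
makes it equal to `I - h` on the pairs that contain `i`. -/
noncomputable def swapVector (hk : 2 ≤ k) (x : PauliMonomial V k → E) (i : V) (z : Sym2 V) : E :=
  (1 / 2 : ℝ) • (x (oneMonomial V k)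
    + edgeSign i z • (x (edgeMonomial hk .X z) + x (edgeMonomial hk .Z z))
    + x (edgeMonomial hk .Y z))

theorem inner_one_swapVector (h : IsMomentMatrix (Matrix.gram ℝ x)) (hk : 2 ≤ k) (i : V)
    (z : Sym2 V) :
    ⟪x (oneMonomial V k), swapVector hk x i z⟫ =
      1 / 2 * (1 + edgeSign i z * (⟪x (oneMonomial V k), x (edgeMonomial hk .X z)⟫
        + ⟪x (oneMonomial V k), x (edgeMonomial hk .Z z)⟫)
        + ⟪x (oneMonomial V k), x (edgeMonomial hk .Y z)⟫) := by
  have hone : ⟪x (oneMonomial V k), x (oneMonomial V k)⟫ = 1 := h.diag _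
  simp only [swapVector, inner_add_right, real_inner_smul_right, hone]

theorem norm_swapVector (h : IsMomentMatrix (Matrix.gram ℝ x)) (hk : 2 ≤ k) (i : V) {z : Sym2 V}
    (hz : ¬ z.IsDiag) : ‖swapVector hk x i z‖ = 1 := by
  have hdiag : ∀ A, ⟪x A, x A⟫ = 1 := h.diag
  have hXY : ⟪x (edgeMonomial hk .X z), x (edgeMonomial hk .Y z)⟫ =
      -⟪x (oneMonomial V k), x (edgeMonomial hk .Z z)⟫ :=
    h.apply_edgeMonomial_of_mat_mul hk PauliLabel.mat_X_mul_mat_Y hz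
  have hYZ : ⟪x (edgeMonomial hk .Y z), x (edgeMonomial hk .Z z)⟫ =
      -⟪x (oneMonomial V k), x (edgeMonomial hk .X z)⟫ :=
    h.apply_edgeMonomial_of_mat_mul hk PauliLabel.mat_Y_mul_mat_Z hz
  have hZX : ⟪x (edgeMonomial hk .Z z), x (edgeMonomial hk .X z)⟫ =
      -⟪x (oneMonomial V k), x (edgeMonomial hk .Y z)⟫ :=
    h.apply_edgeMonomial_of_mat_mul hk PauliLabel.mat_Z_mul_mat_X hz
  rw [← pow_eq_one_iff_of_nonneg (norm_nonneg _) two_ne_zero, ← real_inner_self_eq_norm_sq]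
  simp only [swapVector, inner_add_right, inner_add_left, real_inner_smul_right,
    real_inner_smul_left, hdiag, real_inner_comm (x (oneMonomial V k)), hXY, hYZ, hZX,
    real_inner_comm (x (edgeMonomial hk .X z)) (x (edgeMonomial hk .Y z)),
    real_inner_comm (x (edgeMonomial hk .Y z)) (x (edgeMonomial hk .Z z)),
    real_inner_comm (x (edgeMonomial hk .Z z)) (x (edgeMonomial hk .X z))]
  linear_combination (1 - ⟪x (oneMonomial V k), x (edgeMonomial hk .Y z)⟫) / 2 *
    edgeSign_mul_self i z

theorem two_mul_inner_swapVector_swapVector (h : IsMomentMatrix (Matrix.gram ℝ x)) (hk : 2 ≤ k)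
    (i : V) {a b c : V} (hab : a ≠ b) (hac : a ≠ c) (hbc : b ≠ c) :
    2 * ⟪swapVector hk x i s(a, b), swapVector hk x i s(a, c)⟫ =
      ⟪x (oneMonomial V k), swapVector hk x i s(a, b)⟫
        + ⟪x (oneMonomial V k), swapVector hk x i s(a, c)⟫
        + ⟪x (oneMonomial V k), swapVector hk x i s(b, c)⟫ - 1 := by
  have hone : ⟪x (oneMonomial V k), x (oneMonomial V k)⟫ = 1 := h.diag _
  have hsame : ∀ p, ⟪x (edgeMonomial hk p s(a, b)), x (edgeMonomial hk p s(a, c))⟫ =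
      ⟪x (oneMonomial V k), x (edgeMonomial hk p s(b, c))⟫ := fun p =>
    h.apply_edgeMonomial_of_adjacent hk p hab hac hbc
  have hne : ∀ p q, p ≠ .I → q ≠ .I → p ≠ q →
      ⟪x (edgeMonomial hk p s(a, b)), x (edgeMonomial hk q s(a, c))⟫ = 0 := fun p q hp hq hpq =>
    h.apply_edgeMonomial_of_adjacent_of_ne hk hp hq hpq hbc
  simp only [h.inner_one_swapVector, ← edgeSign_mul_of_adjacent i hab hac hbc]
  simp only [swapVector, inner_add_right, inner_add_left, real_inner_smul_right,
    real_inner_smul_left, hone, real_inner_comm (x (oneMonomial V k)), hsame, ne_eq, reduceCtorEq,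
    not_false_eq_true, hne]
  ring

theorem isSwapSystem_swapVector (h : IsMomentMatrix (Matrix.gram ℝ x)) (hk : 2 ≤ k) (i : V) :
    IsSwapSystem (x (oneMonomial V k)) (swapVector hk x i) where
  norm_ref := by
    rw [← pow_eq_one_iff_of_nonneg (norm_nonneg _) two_ne_zero, ← real_inner_self_eq_norm_sq]
    exact h.diag _
  norm_swap _ hz := h.norm_swapVector hk i hz
  triangle _ _ _ hab hac hbc := h.two_mul_inner_swapVector_swapVector hk i hab hac hbc

theorem momentValue_gram (h : IsMomentMatrix (Matrix.gram ℝ x)) (hk : 2 ≤ k) {i a : V}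
    (hia : i ≠ a) :
    momentValue (Matrix.gram ℝ x) i a =
      -⟪x (oneMonomial V k), swapVector hk x i s(i, a)⟫ := by
  rw [momentValue, h.inner_one_swapVector]
  simp only [h.pseudoExpectation_siteOp_mul_siteOp hk _ hia, Matrix.gram_apply, edgeSign,
    Sym2.mem_mk_left, if_true]
  ring

theorem starMonogamyBound (h : IsMomentMatrix Γ) (hk : 2 ≤ k) {G : SimpleGraph V}
    [DecidableRel G.Adj] {i j : V} (hij : G.Adj i j) :
    StarMonogamyBound G (momentValue Γ) i j := by
  obtain ⟨x, rfl⟩ := exists_eq_gram_of_posSemidef h.posSemidef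
  have hswap := (h.isSwapSystem_swapVector hk i).starMonogamyBound hij
  exact (starMonogamyBound_congr hij fun a ha => h.momentValue_gram hk ha.ne).mpr hswap

end IsMomentMatrix

section States

variable {V : Type*} [Fintype V] [DecidableEq V]

/-- The level-`k` moment matrix of a real linear functional on operators, such as the real part of
the expectation in a pure or mixed state. -/
noncomputable def momentMatrix (φ : QubitOp V →ₗ[ℝ] ℝ) (k : ℕ) :
    Matrix (PauliMonomial V k) (PauliMonomial V k) ℝ :=
  Matrix.of fun A B => φ (pauliOp A.1 * pauliOp B.1)

theorem star_dotProduct_momentMatrix_mulVec (φ : QubitOp V →ₗ[ℝ] ℝ) {k : ℕ}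
    (c : PauliMonomial V k → ℝ) :
    star c ⬝ᵥ (momentMatrix φ k).mulVec c =
      φ ((∑ A, c A • pauliOp A.1).conjTranspose * ∑ A, c A • pauliOp A.1) := by
  simp only [Matrix.conjTranspose_sum, Matrix.conjTranspose_smul, star_trivial,
    (pauliOp_isHermitian _).eq, Finset.sum_mul_sum, map_sum, smul_mul_smul_comm, map_smul,
    smul_eq_mul]
  simp only [dotProduct, Matrix.mulVec, Finset.mul_sum, momentMatrix, Matrix.of_apply]
  exact Finset.sum_congr rfl fun A _ => Finset.sum_congr rfl fun B _ => by ring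

theorem isMomentMatrix_momentMatrix {φ : QubitOp V →ₗ[ℝ] ℝ} (hone : φ 1 = 1)
    (hconj : ∀ C, φ C.conjTranspose = φ C) (hpos : ∀ C, 0 ≤ φ (C.conjTranspose * C)) (k : ℕ) :
    IsMomentMatrix (momentMatrix φ k) where
  posSemidef := by
    refine Matrix.PosSemidef.of_dotProduct_mulVec_nonneg ?_ fun c => ?_
    · ext A B
      simp only [momentMatrix, Matrix.conjTranspose_apply, Matrix.of_apply, star_trivial]
      rw [← hconj, conjTranspose_pauliOp_mul]
    · rw [star_dotProduct_momentMatrix_mulVec]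
      exact hpos _
  eq_of_mul_eq A B A' B' h := by simp only [momentMatrix, Matrix.of_apply, h]
  eq_neg_of_mul_eq_neg A B A' B' h := by simp only [momentMatrix, Matrix.of_apply, h, map_neg]
  eq_zero A B h := by
    have hsign : pauliCommSign A.1 B.1 = -1 :=
      (Int.units_eq_one_or _).resolve_left (mt isHermitian_pauliOp_mul_iff.mpr h)
    have hanti : pauliOp A.1 * pauliOp B.1 = -(pauliOp A.1 * pauliOp B.1).conjTranspose := by
      rw [conjTranspose_pauliOp_mul, pauliOp_mul_comm, hsign]
      simp
    have hneg := congrArg φ hanti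
    rw [map_neg, hconj] at hneg
    exact self_eq_neg.mp hneg
  diag A := by rw [momentMatrix, Matrix.of_apply, pauliOp_mul_self, hone]

theorem pseudoExpectation_momentMatrix_pauliOp (φ : QubitOp V →ₗ[ℝ] ℝ) {k : ℕ}
    (P : PauliMonomial V (2 * k)) :
    pseudoExpectation (momentMatrix φ k) (pauliOp P.1) = φ (pauliOp P.1) := by
  have hfac := exists_pauliOp_factorization P
  rw [pseudoExpectation_pauliOp, pauliMoment, dif_pos hfac, momentMatrix, Matrix.of_apply,
    hfac.choose_spec]

theorem momentValue_momentMatrix {φ : QubitOp V →ₗ[ℝ] ℝ} (hone : φ 1 = 1) {k : ℕ} (hk : 1 ≤ k)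
    {a b : V} (hab : a ≠ b) : momentValue (momentMatrix φ k) a b = φ (eprTerm a b) - 1 := by
  have hpair : ∀ p, pseudoExpectation (momentMatrix φ k) (siteOp p a * siteOp p b) =
      φ (siteOp p a * siteOp p b) := fun p => by
    rw [siteOp_mul_siteOp p hab]
    exact pseudoExpectation_momentMatrix_pauliOp φ (edgeMonomial (by omega) p s(a, b))
  simp only [momentValue, hpair, eprTerm, map_smul, map_add, map_sub, hone, smul_eq_mul]
  ring

/-- The real part of the expectation of an operator in the state vector `ψ`, as a linear
functional. -/
noncomputable def expectationRe (ψ : EuclideanSpace ℂ (V → Fin 2)) : QubitOp V →ₗ[ℝ] ℝ where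
  toFun C := (star ψ.ofLp ⬝ᵥ C.mulVec ψ.ofLp).re
  map_add' C D := by rw [Matrix.add_mulVec, dotProduct_add, Complex.add_re]
  map_smul' r C := by
    rw [Matrix.smul_mulVec, dotProduct_smul, Complex.smul_re, RingHom.id_apply]

theorem expectationRe_one {ψ : EuclideanSpace ℂ (V → Fin 2)} (hψ : ‖ψ‖ = 1) :
    expectationRe ψ 1 = 1 := by
  change (star ψ.ofLp ⬝ᵥ (1 : QubitOp V).mulVec ψ.ofLp).re = 1
  rw [Matrix.one_mulVec, dotProduct_comm, ← EuclideanSpace.inner_eq_star_dotProduct,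
    inner_self_eq_norm_sq_to_K, hψ]
  simp

theorem expectationRe_conjTranspose (ψ : EuclideanSpace ℂ (V → Fin 2)) (C : QubitOp V) :
    expectationRe ψ C.conjTranspose = expectationRe ψ C := by
  change (star ψ.ofLp ⬝ᵥ C.conjTranspose.mulVec ψ.ofLp).re = (star ψ.ofLp ⬝ᵥ C.mulVec ψ.ofLp).re
  rw [Matrix.dotProduct_mulVec, ← Matrix.star_mulVec, Matrix.star_dotProduct, RCLike.star_def,
    Complex.conj_re]

open scoped ComplexOrder in
theorem expectationRe_conjTranspose_mul_self_nonneg (ψ : EuclideanSpace ℂ (V → Fin 2))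
    (C : QubitOp V) : 0 ≤ expectationRe ψ (C.conjTranspose * C) := by
  change 0 ≤ (star ψ.ofLp ⬝ᵥ (C.conjTranspose * C).mulVec ψ.ofLp).re
  rw [← Matrix.mulVec_mulVec, Matrix.dotProduct_mulVec, ← Matrix.star_mulVec]
  exact (Complex.le_def.mp (dotProduct_star_self_nonneg (C.mulVec ψ.ofLp))).1

theorem starMonogamyBound_stateValue {ψ : EuclideanSpace ℂ (V → Fin 2)} (hψ : ‖ψ‖ = 1)
    {G : SimpleGraph V} [DecidableRel G.Adj] {i j : V} (hij : G.Adj i j) :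
    StarMonogamyBound G (stateValue ψ) i j := by
  have hval : ∀ a, G.Adj i a →
      stateValue ψ i a = momentValue (momentMatrix (expectationRe ψ) 2) i a := fun a ha =>
    (momentValue_momentMatrix (expectationRe_one hψ) one_le_two ha.ne).symm
  rw [starMonogamyBound_congr hij hval]
  exact (isMomentMatrix_momentMatrix (expectationRe_one hψ) (expectationRe_conjTranspose ψ)
    (expectationRe_conjTranspose_mul_self_nonneg ψ) 2).starMonogamyBound le_rfl hij

end States

theorem mainTheorem2 {V : Type*} [Fintype V] [DecidableEq V] (G : SimpleGraph V)
    [DecidableRel G.Adj] (w : Sym2 V → ℝ) (hw : ∀ e ∈ G.edgeSet, 0 < w e)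
    (i j : V) (hd : 2 ≤ G.degree i) (hij : G.Adj i j) :
    (∀ ψ : EuclideanSpace ℂ (V → Fin 2), ‖ψ‖ = 1 → StarMonogamyBound G (stateValue ψ) i j) ∧
    (∀ k : ℕ, 2 ≤ k → ∀ Γ : Matrix (PauliMonomial V k) (PauliMonomial V k) ℝ,
      IsMomentMatrix Γ → StarMonogamyBound G (momentValue Γ) i j) ∧
    (∀ k : ℕ, 2 ≤ k → ∀ Γ : Matrix (PauliMonomial V k) (PauliMonomial V k) ℝ,
      IsMomentSoSSolution G w Γ → StarMonogamyBound G (momentValue Γ) i j) :=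
  ⟨fun _ hψ => starMonogamyBound_stateValue hψ hij, fun _ hk _ hΓ => hΓ.starMonogamyBound hk hij,
    fun _ hk _ hΓ => hΓ.1.starMonogamyBound hk hij⟩
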